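/- Let $D=\{(x,y)\in\mathbb R^2: x^2+y^2<1\}$ with the metric $g_0=\frac{4(dx^2+dy^2)}{(1-x^2-y^2)^2}$ be the hyperbolic plane $H^2(-1)$, and let $B=\{(x,y,z): x^2+y^2+z^2<1\}$ with the metric $h_0=\frac{4(dx^2+dy^2+dz^2)}{(1-x^2-y^2-z^2)^2}$ be hyperbolic 3-space $H^3(-1)$. Let $U\subseteq D$ be a nonempty open set (for instance $U=D$), let $w$ be a positive harmonic function on $U$ (i.e. $w_{xx}+w_{yy}=0$), put $\rho=\sqrt{1-x^2-y^2}$ and $$\beta(x,y,z)=\frac{2\rho^3}{-2\rho z-2(\rho^2-z^2)\arctan\frac{z}{\rho}+w(x,y)\,\rho^3(\rho^2-z^2)},$$ and let $N=\{(x,y,z)\in B:(x,y)\in U,\ \beta(x,y,z)>0\}$. Then $N$ is open, $h=\beta^{-2}h_0$ is a smooth Riemannian metric on $N$, and the map $\varphi:(U,g_0)\to(N,h)$, $\varphi(x,y)=(x,y,0)$, is a conformal immersion with conformal factor $\lambda=\frac{w(x,y)(1-x^2-y^2)}{2}$ (that is, $\varphi^*h=\lambda^2g_0$) which is proper biharmonic: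 its bitension field $$\tau_2(\varphi)=\mathrm{Trace}_{g_0}(\nabla^\varphi\nabla^\varphi-\nabla^\varphi_{\nabla^{g_0}})\tau(\varphi)-\mathrm{Trace}_{g_0}R^{h}(d\varphi,\tau(\varphi))d\varphi$$ vanishes identically on $U$, while its tension field $\tau(\varphi)=\mathrm{Trace}_{g_0}\nabla d\varphi$ does not. Here $R^h(X,Y)Z=\nabla_X\nabla_YZ-\nabla_Y\nabla_XZ-\nabla_{[X,Y]}Z$. -/

import Mathlib

open Matrix
open scoped ContDiff

noncomputable section

/-- Coordinate space `ℝⁿ` with its Euclidean norm. -/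
abbrev Coord (n : ℕ) : Type := EuclideanSpace ℝ (Fin n)

/-- The partial derivative `∂f/∂xᵢ` at `p`. -/
def pderiv {n : ℕ} (i : Fin n) (f : Coord n → ℝ) (p : Coord n) : ℝ :=
  fderiv ℝ f p (EuclideanSpace.single i 1)

/-- The matrix field `g` (the Gram matrices of the coordinate frame) is a smooth Riemannian metric
on the set `U` of coordinate space. -/
structure IsRiemannianMetricOn {n : ℕ} (g : Coord n → Matrix (Fin n) (Fin n) ℝ)
    (U : Set (Coord n)) : Prop where
  smooth : ∀ i j, ContDiffOn ℝ ∞ (fun p => g p i j) U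
  posDef : ∀ p ∈ U, (g p).PosDef

/-- Christoffel symbols `Γᵏᵢⱼ = ½ Σₗ gᵏˡ (∂ᵢ gⱼₗ + ∂ⱼ gᵢₗ - ∂ₗ gᵢⱼ)` of the Levi-Civita connection
of `g`. -/
def christoffel {n : ℕ} (g : Coord n → Matrix (Fin n) (Fin n) ℝ) (k i j : Fin n)
    (p : Coord n) : ℝ :=
  (1 / 2) * ∑ l, (g p)⁻¹ k l *
    (pderiv i (fun q => g q j l) p + pderiv j (fun q => g q i l) p - pderiv l (fun q => g q i j) p)

/-- Components of the Riemann curvature of `g`, with the convention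
`R(X,Y)Z = ∇_X ∇_Y Z - ∇_Y ∇_X Z - ∇_[X,Y] Z`: one has
`R(∂_b, ∂_c) ∂_d = Σₐ (curvature g a b c d) ∂ₐ`. -/
def curvature {n : ℕ} (g : Coord n → Matrix (Fin n) (Fin n) ℝ) (a b c d : Fin n)
    (p : Coord n) : ℝ :=
  pderiv b (christoffel g a c d) p - pderiv c (christoffel g a b d) p
    + ∑ e, (christoffel g a b e p * christoffel g e c d p
      - christoffel g a c e p * christoffel g e b d p)

/-- The pullback `φ^* h`, as a matrix field. -/
def pullbackMetric {m n : ℕ} (h : Coord n → Matrix (Fin n) (Fin n) ℝ) (φ : Coord m → Coord n)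
    (p : Coord m) : Matrix (Fin m) (Fin m) ℝ :=
  Matrix.of fun i j =>
    ∑ a, ∑ b, h (φ p) a b * pderiv i (fun q => φ q a) p * pderiv j (fun q => φ q b) p

/-- The pullback connection `∇^φ`: component `a` of `∇^φ_{∂ᵢ} V`, for a section `V` of the pullback
of the tangent bundle of `(ℝⁿ, h)` under `φ`. -/
def pullbackCovDeriv {m n : ℕ} (h : Coord n → Matrix (Fin n) (Fin n) ℝ) (φ : Coord m → Coord n)
    (V : Coord m → Fin n → ℝ) (i : Fin m) (p : Coord m) (a : Fin n) : ℝ :=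
  pderiv i (fun q => V q a) p
    + ∑ b, ∑ c, christoffel h a b c (φ p) * pderiv i (fun q => φ q b) p * V p c

/-- The tension field `τ(φ) = Trace_g ∇dφ`, where
`(∇dφ)(∂ᵢ, ∂ⱼ) = ∇^φ_{∂ᵢ} (dφ ∂ⱼ) - dφ(∇^M_{∂ᵢ} ∂ⱼ)`. -/
def tensionField {m n : ℕ} (g : Coord m → Matrix (Fin m) (Fin m) ℝ)
    (h : Coord n → Matrix (Fin n) (Fin n) ℝ) (φ : Coord m → Coord n)
    (p : Coord m) (a : Fin n) : ℝ :=
  ∑ i, ∑ j, (g p)⁻¹ i j *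
    (pullbackCovDeriv h φ (fun q b => pderiv j (fun r => φ r b) q) i p a
      - ∑ k, christoffel g k i j p * pderiv k (fun q => φ q a) p)

/-- The bitension field
`τ₂(φ) = Trace_g (∇^φ ∇^φ - ∇^φ_{∇^M}) τ(φ) - Trace_g R^N(dφ, τ(φ)) dφ`. -/
def bitensionField {m n : ℕ} (g : Coord m → Matrix (Fin m) (Fin m) ℝ)
    (h : Coord n → Matrix (Fin n) (Fin n) ℝ) (φ : Coord m → Coord n)
    (p : Coord m) (a : Fin n) : ℝ :=
  (∑ i, ∑ j, (g p)⁻¹ i j *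
    (pullbackCovDeriv h φ (fun q => pullbackCovDeriv h φ (tensionField g h φ) j q) i p a
      - ∑ k, christoffel g k i j p * pullbackCovDeriv h φ (tensionField g h φ) k p a))
  - ∑ i, ∑ j, (g p)⁻¹ i j *
    ∑ b, ∑ c, ∑ d, curvature h a b c d (φ p)
      * pderiv i (fun q => φ q b) p * tensionField g h φ p c * pderiv j (fun q => φ q d) p

/-- `φ : (U, g) → (·, h)` is a harmonic map: its tension field vanishes identically on `U`. -/
def IsHarmonicMapOn {m n : ℕ} (g : Coord m → Matrix (Fin m) (Fin m) ℝ)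
    (h : Coord n → Matrix (Fin n) (Fin n) ℝ) (φ : Coord m → Coord n) (U : Set (Coord m)) : Prop :=
  ∀ p ∈ U, tensionField g h φ p = 0

/-- `φ : (U, g) → (·, h)` is a biharmonic map: its bitension field vanishes identically on `U`. -/
def IsBiharmonicMapOn {m n : ℕ} (g : Coord m → Matrix (Fin m) (Fin m) ℝ)
    (h : Coord n → Matrix (Fin n) (Fin n) ℝ) (φ : Coord m → Coord n) (U : Set (Coord m)) : Prop :=
  ∀ p ∈ U, bitensionField g h φ p = 0

/-- Proper biharmonic: biharmonic and not harmonic. -/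
def IsProperBiharmonicMapOn {m n : ℕ} (g : Coord m → Matrix (Fin m) (Fin m) ℝ)
    (h : Coord n → Matrix (Fin n) (Fin n) ℝ) (φ : Coord m → Coord n) (U : Set (Coord m)) : Prop :=
  IsBiharmonicMapOn g h φ U ∧ ¬ IsHarmonicMapOn g h φ U

/-- `φ : (U, g) → (N, h)` is a smooth conformal immersion with conformal factor `factor > 0`, that
is, `φ^* h = factor² g` on `U`. -/
structure IsConformalImmersionOn {m n : ℕ} (g : Coord m → Matrix (Fin m) (Fin m) ℝ)
    (h : Coord n → Matrix (Fin n) (Fin n) ℝ) (φ : Coord m → Coord n)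
    (U : Set (Coord m)) (N : Set (Coord n)) (factor : Coord m → ℝ) : Prop where
  mapsTo : Set.MapsTo φ U N
  smooth : ContDiffOn ℝ ∞ φ U
  immersion : ∀ p ∈ U, Function.Injective (fderiv ℝ φ p)
  factor_pos : ∀ p ∈ U, 0 < factor p
  conformal : ∀ p ∈ U, pullbackMetric h φ p = factor p ^ 2 • g p

/-- The metric `4 (dx₁² + ⋯ + dxₙ²) / (1 - |x|²)²` of curvature `-1`; hyperbolic space `Hⁿ(-1)` is
the unit ball `Metric.ball 0 1` with this metric. -/
def hyperbolicMetric (n : ℕ) (p : Coord n) : Matrix (Fin n) (Fin n) ℝ :=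
  (4 / (1 - ‖p‖ ^ 2) ^ 2) • (1 : Matrix (Fin n) (Fin n) ℝ)

/-- `ρ = √(1 - x² - y²)`. -/
def rhoFn (x y : ℝ) : ℝ := √(1 - x ^ 2 - y ^ 2)

/-- `β = 2ρ³ / (-2ρz - 2(ρ² - z²) arctan(z/ρ) + w(x,y) ρ³ (ρ² - z²))`. -/
def betaFn (w : Coord 2 → ℝ) (p : Coord 3) : ℝ :=
  2 * rhoFn (p 0) (p 1) ^ 3 /
    (-2 * rhoFn (p 0) (p 1) * p 2
      - 2 * (rhoFn (p 0) (p 1) ^ 2 - p 2 ^ 2) * Real.arctan (p 2 / rhoFn (p 0) (p 1))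
      + w !₂[p 0, p 1] * rhoFn (p 0) (p 1) ^ 3 * (rhoFn (p 0) (p 1) ^ 2 - p 2 ^ 2))

/-- The part of hyperbolic 3-space that lies over `U` (where `w` is given) and on which `β > 0`. -/
def betaDomain (U : Set (Coord 2)) (w : Coord 2 → ℝ) : Set (Coord 3) :=
  {p | p ∈ Metric.ball (0 : Coord 3) 1 ∧ !₂[p 0, p 1] ∈ U ∧ 0 < betaFn w p}

/-- The conformally changed hyperbolic metric `β⁻² h₀`. -/
def conformalHyperbolicMetric (w : Coord 2 → ℝ) (p : Coord 3) : Matrix (Fin 3) (Fin 3) ℝ :=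
  (betaFn w p ^ 2)⁻¹ • hyperbolicMetric 3 p

/-- The inclusion `(x, y) ↦ (x, y, 0)`. -/
def planeInclusion (p : Coord 2) : Coord 3 := !₂[p 0, p 1, 0]

end

/-! Both metrics are conformally flat: `g₀ = u² I` with `u = 2/ρ²`, and `β⁻² h₀ = f² I` with `f = w
- 2z/(ρ²(ρ² - z²)) - (2/ρ³) arctan(z/ρ)` (`spaceFactor`). Only four facts about `f` on the plane `z
= 0` matter: `f = w`, `f_z = -u²`, `f_zz = 0` and `f_xx + f_yy = 0`.

The inclusion is conformal on a surface, so its tension field is normal, namely `-2 f_z/(u² f) ∂_z`.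
The condition `f_z = -u²` turns this into `(2/f) ∂_z`, twice the unit normal, which is never zero.
Having constant length, its covariant derivatives are tangential: `∇_i τ = (2 f_z/f²) ∂_i`. In the
bitension field the common factor `u⁻²` drops out. The normal components of rough Laplacian and
curvature trace are both `-4 f_z²/f³`, thanks to `f_zz = 0` and `f_xx + f_yy = 0`; the tangential
ones are both the derivative of `2 f_z/f²` (`isBiharmonicMapOn_planeInclusion`, with
`sum_curvature_conformallyFlat`). -/

open Topology

/-! ### Harmonic functions on the plane. -/

open InnerProductSpace Topology in
-- The Laplacian can be computed in any orthonormal basis, and an isometry carries one such basis to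
-- another.
theorem InnerProductSpace.HarmonicAt.comp_linearIsometryEquiv {E E' F : Type*}
    [NormedAddCommGroup E] [InnerProductSpace ℝ E] [FiniteDimensional ℝ E]
    [NormedAddCommGroup E'] [InnerProductSpace ℝ E'] [FiniteDimensional ℝ E']
    [NormedAddCommGroup F] [NormedSpace ℝ F] {f : E → F} (L : E' ≃ₗᵢ[ℝ] E) {x : E'}
    (hf : HarmonicAt f (L x)) : HarmonicAt (f ∘ L) x := by
  refine ⟨hf.1.comp x L.contDiff.contDiffAt, ?_⟩
  filter_upwards [L.continuous.continuousAt.eventually hf.2] with y hy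
  rw [laplacian_eq_iteratedFDeriv_orthonormalBasis f ((stdOrthonormalBasis ℝ E').map L)] at hy
  rw [laplacian_eq_iteratedFDeriv_stdOrthonormalBasis]
  simp only [Pi.zero_apply] at hy ⊢
  rw [← hy]
  refine Finset.sum_congr rfl fun i _ => ?_
  have h := L.toContinuousLinearEquiv.iteratedFDerivWithin_comp_right (x := y) f
    uniqueDiffOn_univ (Set.mem_univ _) 2
  have h' : f ∘ L.toContinuousLinearEquiv = f ∘ L := rfl
  simp only [Set.preimage_univ, iteratedFDerivWithin_univ, h'] at h
  rw [h]
  simp only [ContinuousMultilinearMap.compContinuousLinearMap_apply, OrthonormalBasis.map_apply]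
  have e : (fun k => (L.toContinuousLinearEquiv : E' →L[ℝ] E)
      ((![stdOrthonormalBasis ℝ E' i, stdOrthonormalBasis ℝ E' i] : Fin 2 → E') k))
      = ![L (stdOrthonormalBasis ℝ E' i), L (stdOrthonormalBasis ℝ E' i)] := by
    funext k
    fin_cases k <;> rfl
  exact congrArg _ e

/-- Harmonic functions on the Euclidean plane are real analytic. -/
theorem InnerProductSpace.HarmonicAt.analyticAt_plane {f : Coord 2 → ℝ} {x : Coord 2}
    (hf : InnerProductSpace.HarmonicAt f x) : AnalyticAt ℝ f x := by
  -- Identify the plane isometrically with `ℂ`, where harmonic functions are analytic.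
  let L : ℂ ≃ₗᵢ[ℝ] Coord 2 := Complex.orthonormalBasisOneI.repr
  have h : InnerProductSpace.HarmonicAt (f ∘ L) (L.symm x) :=
    InnerProductSpace.HarmonicAt.comp_linearIsometryEquiv L (by simpa using hf)
  have h2 : AnalyticAt ℝ ((f ∘ L) ∘ L.symm) x :=
    (HarmonicAt.analyticAt h).comp
      (L.symm.toContinuousLinearEquiv.toContinuousLinearMap.analyticAt x)
  have e : (f ∘ L) ∘ L.symm = f := by
    funext y
    simp
  rwa [e] at h2

/-- The Laplace equation in coordinates. -/
theorem InnerProductSpace.HarmonicAt.sum_pderiv_pderiv {n : ℕ} {f : Coord n → ℝ} {x : Coord n}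
    (hf : InnerProductSpace.HarmonicAt f x) : ∑ i, pderiv i (pderiv i f) x = 0 := by
  have h := hf.2.eq_of_nhds
  rw [InnerProductSpace.laplacian_eq_iteratedFDeriv_orthonormalBasis f
    (EuclideanSpace.basisFun (Fin n) ℝ)] at h
  simp only [Pi.zero_apply] at h
  rw [← h]
  refine Finset.sum_congr rfl fun i _ => ?_
  have hd : DifferentiableAt ℝ (fderiv ℝ f) x :=
    (hf.1.fderiv_right (m := 1) (by norm_num)).differentiableAt (by norm_num)
  rw [iteratedFDeriv_two_apply]
  have : pderiv i f = fun q => fderiv ℝ f q (EuclideanSpace.single i 1) := rfl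
  rw [this, pderiv, fderiv_clm_apply hd (by fun_prop)]
  simp

/-! ### Calculus of partial derivatives. -/

section pderiv
variable {n : ℕ} {i j : Fin n} {f g : Coord n → ℝ} {p : Coord n}

theorem pderiv_congr (h : f =ᶠ[𝓝 p] g) : pderiv i f p = pderiv i g p := by
  simp only [pderiv, h.fderiv_eq]

theorem pderiv_const (c : ℝ) : pderiv i (fun _ : Coord n => c) p = 0 := by
  simp [pderiv]

theorem pderiv_add (hf : DifferentiableAt ℝ f p) (hg : DifferentiableAt ℝ g p) :
    pderiv i (fun q => f q + g q) p = pderiv i f p + pderiv i g p := by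
  simp [pderiv, fderiv_fun_add hf hg]

theorem pderiv_sub (hf : DifferentiableAt ℝ f p) (hg : DifferentiableAt ℝ g p) :
    pderiv i (fun q => f q - g q) p = pderiv i f p - pderiv i g p := by
  simp [pderiv, fderiv_fun_sub hf hg]

theorem pderiv_mul (hf : DifferentiableAt ℝ f p) (hg : DifferentiableAt ℝ g p) :
    pderiv i (fun q => f q * g q) p = f p * pderiv i g p + g p * pderiv i f p := by
  simp [pderiv, fderiv_fun_mul hf hg]

theorem pderiv_inv (hf : DifferentiableAt ℝ f p) (h : f p ≠ 0) :
    pderiv i (fun q => (f q)⁻¹) p = -pderiv i f p / f p ^ 2 := by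
  have := (hasDerivAt_inv h).comp_hasFDerivAt p hf.hasFDerivAt
  have e := this.fderiv
  simp only [pderiv]
  rw [show (fun q => (f q)⁻¹) = (fun y => y⁻¹) ∘ f from rfl, e]
  simp
  ring

theorem pderiv_div (hf : DifferentiableAt ℝ f p) (hg : DifferentiableAt ℝ g p) (h : g p ≠ 0) :
    pderiv i (fun q => f q / g q) p
      = (pderiv i f p * g p - f p * pderiv i g p) / g p ^ 2 := by
  simp only [div_eq_mul_inv (f _)]
  have hi : DifferentiableAt ℝ (fun q => (g q)⁻¹) p := hg.inv h
  rw [pderiv_mul hf hi, pderiv_inv hg h]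
  field_simp
  ring

/-- Reduces `∂/∂z` to a one-variable derivative, along which `ρ` and `w` are constant. -/
theorem pderiv_eq_of_hasDerivAt_line {d : ℝ} (hf : DifferentiableAt ℝ f p)
    (h : HasDerivAt (fun t : ℝ => f (p + t • EuclideanSpace.single i 1)) d 0) :
    pderiv i f p = d := by
  rw [pderiv, ← hf.lineDeriv_eq_fderiv]
  exact h.deriv

theorem ContDiffAt.differentiableAt_pderiv (hf : ContDiffAt ℝ 2 f p) :
    DifferentiableAt ℝ (pderiv i f) p := by
  have hd : DifferentiableAt ℝ (fderiv ℝ f) p :=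
    (hf.fderiv_right (m := 1) (by norm_num)).differentiableAt (by norm_num)
  exact hd.clm_apply (differentiableAt_const _)

theorem ContDiffAt.pderiv_comm (hf : ContDiffAt ℝ 2 f p) :
    pderiv i (pderiv j f) p = pderiv j (pderiv i f) p := by
  have hd : DifferentiableAt ℝ (fderiv ℝ f) p :=
    (hf.fderiv_right (m := 1) (by norm_num)).differentiableAt (by norm_num)
  have key : ∀ k l : Fin n, pderiv k (pderiv l f) p
      = fderiv ℝ (fderiv ℝ f) p (EuclideanSpace.single k 1) (EuclideanSpace.single l 1) := by
    intro k l
    have : pderiv l f = fun q => fderiv ℝ f q (EuclideanSpace.single l 1) := rfl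
    rw [this, pderiv, fderiv_clm_apply hd (by fun_prop)]
    simp
  rw [key, key]
  exact hf.isSymmSndFDerivAt (by simp) _ _

end pderiv

/-! ### Conformally flat metrics -/

section conformallyFlat
variable {n : ℕ} {g : Coord n → Matrix (Fin n) (Fin n) ℝ} {f : Coord n → ℝ} {p : Coord n}

theorem inv_sq_smul_one_apply {c : ℝ} (hc : c ≠ 0) (i j : Fin n) :
    ((c ^ 2 • (1 : Matrix (Fin n) (Fin n) ℝ))⁻¹) i j = if i = j then (c ^ 2)⁻¹ else 0 := by
  have : (c ^ 2 • (1 : Matrix (Fin n) (Fin n) ℝ))⁻¹ = (c ^ 2)⁻¹ • 1 := by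
    apply Matrix.inv_eq_right_inv
    simp [smul_smul, hc]
  rw [this]
  simp [Matrix.one_apply]

theorem pderiv_conformallyFlat (hg : ∀ᶠ q in 𝓝 p, g q = f q ^ 2 • 1)
    (hf : DifferentiableAt ℝ f p) (i j k : Fin n) :
    pderiv k (fun q => g q i j) p = if i = j then 2 * f p * pderiv k f p else 0 := by
  have h : (fun q => g q i j) =ᶠ[𝓝 p] fun q => if i = j then f q * f q else 0 := by
    filter_upwards [hg] with q hq
    simp [hq, Matrix.one_apply, sq]
  rw [pderiv_congr h]
  split_ifs
  · rw [pderiv_mul hf hf]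
    ring
  · exact pderiv_const 0

/-- Christoffel symbols of a conformally flat metric `f² I`. -/
theorem christoffel_conformallyFlat (hg : ∀ᶠ q in 𝓝 p, g q = f q ^ 2 • 1)
    (hf : DifferentiableAt ℝ f p) (h0 : f p ≠ 0) (k i j : Fin n) :
    christoffel g k i j p = (if k = j then pderiv i f p / f p else 0)
      + (if k = i then pderiv j f p / f p else 0) - (if i = j then pderiv k f p / f p else 0) := by
  simp only [christoffel, pderiv_conformallyFlat hg hf, hg.self_of_nhds, inv_sq_smul_one_apply h0]
  simp only [ite_mul, zero_mul, Finset.sum_ite_eq, Finset.mem_univ, if_true]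
  simp only [eq_comm (a := i) (b := k), eq_comm (a := j) (b := k)]
  split_ifs <;> field_simp <;> ring

theorem pderiv_logDeriv (hf : ContDiffAt ℝ 2 f p) (h0 : f p ≠ 0) (i j : Fin n) :
    pderiv i (fun q => pderiv j f q / f q) p
      = (pderiv i (pderiv j f) p * f p - pderiv j f p * pderiv i f p) / f p ^ 2 :=
  pderiv_div hf.differentiableAt_pderiv (hf.differentiableAt (by norm_num)) h0

theorem pderiv_christoffel_conformallyFlat (hg : ∀ᶠ q in 𝓝 p, g q = f q ^ 2 • 1)
    (hf : ContDiffAt ℝ 2 f p) (h0 : f p ≠ 0) (l k i j : Fin n) :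
    pderiv l (christoffel g k i j) p
      = (if k = j then pderiv l (fun q => pderiv i f q / f q) p else 0)
      + (if k = i then pderiv l (fun q => pderiv j f q / f q) p else 0)
      - (if i = j then pderiv l (fun q => pderiv k f q / f q) p else 0) := by
  have hc : ContinuousAt f p := hf.continuousAt
  have e : christoffel g k i j =ᶠ[𝓝 p] fun q => (if k = j then pderiv i f q / f q else 0)
      + (if k = i then pderiv j f q / f q else 0) - (if i = j then pderiv k f q / f q else 0) := by
    -- The closed form is about to be differentiated, so it is needed on a neighbourhood of `p`.
    filter_upwards [hg.eventually_nhds, hf.eventually (by simp), hc.eventually_ne h0]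
      with q h1 h2 h3
    exact christoffel_conformallyFlat h1 (h2.differentiableAt (by norm_num)) h3 k i j
  have hd : ∀ (P : Prop) [Decidable P] (m : Fin n),
      DifferentiableAt ℝ (fun q => if P then pderiv m f q / f q else 0) p := by
    intro P _ m
    split_ifs
    · have hi : DifferentiableAt ℝ (fun q => (f q)⁻¹) p :=
        (hf.differentiableAt (by norm_num)).inv h0
      simpa only [div_eq_mul_inv] using hf.differentiableAt_pderiv.fun_mul hi
    · exact differentiableAt_const _
  rw [pderiv_congr e, pderiv_sub ((hd _ _).fun_add (hd _ _)) (hd _ _), pderiv_add (hd _ _) (hd _ _)]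
  have hp : ∀ (P : Prop) [Decidable P] (m : Fin n),
      pderiv l (fun q => if P then pderiv m f q / f q else 0) p
        = if P then pderiv l (fun q => pderiv m f q / f q) p else 0 := by
    intro P _ m
    split_ifs
    · rfl
    · exact pderiv_const 0
  rw [hp, hp, hp]

end conformallyFlat

/-! ### The plane `z = 0` -/

theorem planeInclusion_zero (p : Coord 2) : planeInclusion p 0 = p 0 := rfl
theorem planeInclusion_one (p : Coord 2) : planeInclusion p 1 = p 1 := rfl
theorem planeInclusion_two (p : Coord 2) : planeInclusion p 2 = 0 := rfl

/-- The inclusion of the plane as a continuous linear map. -/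
noncomputable def planeInclusionL : Coord 2 →L[ℝ] Coord 3 :=
  LinearMap.toContinuousLinearMap
    { toFun := planeInclusion
      map_add' := fun x y => by
        ext i
        fin_cases i <;> simp [planeInclusion]
      map_smul' := fun c x => by
        ext i
        fin_cases i <;> simp [planeInclusion] }

theorem coe_planeInclusionL : (planeInclusionL : Coord 2 → Coord 3) = planeInclusion := rfl

theorem contDiff_planeInclusion : ContDiff ℝ ∞ planeInclusion :=
  planeInclusionL.contDiff

theorem fderiv_planeInclusion (p : Coord 2) : fderiv ℝ planeInclusion p = planeInclusionL :=
  planeInclusionL.fderiv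

theorem planeInclusionL_single (i : Fin 2) :
    planeInclusionL (EuclideanSpace.single i 1) = EuclideanSpace.single i.castSucc 1 := by
  change planeInclusion _ = _
  ext j
  fin_cases i <;> fin_cases j <;> simp [planeInclusion]

theorem pderiv_comp_planeInclusion {F : Coord 3 → ℝ} {p : Coord 2}
    (hF : DifferentiableAt ℝ F (planeInclusion p)) (i : Fin 2) :
    pderiv i (fun q => F (planeInclusion q)) p = pderiv i.castSucc F (planeInclusion p) := by
  have h : HasFDerivAt (fun q => F (planeInclusion q))
      ((fderiv ℝ F (planeInclusion p)).comp planeInclusionL) p :=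
    HasFDerivAt.comp p (g := F) hF.hasFDerivAt planeInclusionL.hasFDerivAt
  rw [pderiv, h.fderiv, ContinuousLinearMap.comp_apply, planeInclusionL_single]
  rfl

theorem pderiv_planeInclusion (p : Coord 2) (i : Fin 2) (a : Fin 3) :
    pderiv i (fun q => planeInclusion q a) p = if a = i.castSucc then 1 else 0 := by
  have h := pderiv_comp_planeInclusion (F := fun q : Coord 3 => q a) (p := p) (by fun_prop) i
  rw [h, pderiv]
  have e : HasFDerivAt (fun q : Coord 3 => q a) (EuclideanSpace.proj a : Coord 3 →L[ℝ] ℝ)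
    (planeInclusion p) := (EuclideanSpace.proj a : Coord 3 →L[ℝ] ℝ).hasFDerivAt
  rw [e.fderiv]
  simp

theorem pullbackCovDeriv_planeInclusion (h : Coord 3 → Matrix (Fin 3) (Fin 3) ℝ)
    (V : Coord 2 → Fin 3 → ℝ) (i : Fin 2) (p : Coord 2) (a : Fin 3) :
    pullbackCovDeriv h planeInclusion V i p a = pderiv i (fun q => V q a) p
      + ∑ c, christoffel h a i.castSucc c (planeInclusion p) * V p c := by
  simp only [pullbackCovDeriv, pderiv_planeInclusion]
  congr 1
  rw [Finset.sum_comm]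
  simp

theorem pullbackCovDeriv_congr {m n : ℕ} {h : Coord n → Matrix (Fin n) (Fin n) ℝ}
    {φ : Coord m → Coord n} {V W : Coord m → Fin n → ℝ} {p : Coord m} (e : V =ᶠ[𝓝 p] W)
    (i : Fin m) (a : Fin n) : pullbackCovDeriv h φ V i p a = pullbackCovDeriv h φ W i p a := by
  have e' : (fun q => V q a) =ᶠ[𝓝 p] fun q => W q a := by
    filter_upwards [e] with q hq
    rw [hq]
  simp only [pullbackCovDeriv, e.self_of_nhds, pderiv_congr e']

/-- In dimension two the trace of the Christoffel symbols of a conformally flat metric vanishes. -/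
theorem sum_christoffel_conformallyFlat_plane {g : Coord 2 → Matrix (Fin 2) (Fin 2) ℝ}
    {u : Coord 2 → ℝ} {p : Coord 2} (hg : ∀ᶠ q in 𝓝 p, g q = u q ^ 2 • 1)
    (hu : DifferentiableAt ℝ u p) (h0 : u p ≠ 0) (k : Fin 2) :
    ∑ i, christoffel g k i i p = 0 := by
  -- In dimension `n` the sum would be `(2 - n) ∂ₖu/u`.
  simp only [christoffel_conformallyFlat hg hu h0]
  fin_cases k <;> simp <;> ring

/-! ### The plane `z = 0` in a conformally flat space -/

section biharmonic
variable {U : Set (Coord 2)} {g : Coord 2 → Matrix (Fin 2) (Fin 2) ℝ} {u : Coord 2 → ℝ}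
  {h : Coord 3 → Matrix (Fin 3) (Fin 3) ℝ} {f : Coord 3 → ℝ}

theorem sum_inv_conformallyFlat_plane {c : ℝ} (hc : c ≠ 0) (M : Fin 2 → Fin 2 → ℝ) :
    ∑ i, ∑ j, ((c ^ 2 • (1 : Matrix (Fin 2) (Fin 2) ℝ))⁻¹) i j * M i j
      = (c ^ 2)⁻¹ * ∑ i, M i i := by
  simp only [inv_sq_smul_one_apply hc, ite_mul, zero_mul, Finset.sum_ite_eq, Finset.mem_univ,
    if_true, Finset.mul_sum]

theorem sum_christoffel_mul_conformallyFlat_plane {p : Coord 2}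
    (hg : ∀ᶠ q in 𝓝 p, g q = u q ^ 2 • 1) (hu : DifferentiableAt ℝ u p) (h0 : u p ≠ 0)
    (X : Fin 2 → ℝ) : ∑ i, ∑ k, christoffel g k i i p * X k = 0 := by
  rw [Finset.sum_comm]
  simp only [← Finset.sum_mul, sum_christoffel_conformallyFlat_plane hg hu h0, zero_mul,
    Finset.sum_const_zero]

/-- The tension field of the plane `z = 0`, when the conformal factors satisfy `∂f/∂z = -u²`. -/
theorem tensionField_planeInclusion (hU : IsOpen U) (hg : ∀ p ∈ U, g p = u p ^ 2 • 1)
    (hu : ∀ p ∈ U, DifferentiableAt ℝ u p) (hu0 : ∀ p ∈ U, u p ≠ 0)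
    (hh : ∀ p ∈ U, ∀ᶠ q in 𝓝 (planeInclusion p), h q = f q ^ 2 • 1)
    (hf : ∀ p ∈ U, ContDiffAt ℝ 2 f (planeInclusion p))
    (hf0 : ∀ p ∈ U, f (planeInclusion p) ≠ 0)
    (hz : ∀ p ∈ U, pderiv 2 f (planeInclusion p) = -u p ^ 2) {p : Coord 2} (hp : p ∈ U) :
    tensionField g h planeInclusion p = fun a => if a = 2 then 2 / f (planeInclusion p) else 0 := by
  have hg' : ∀ᶠ q in 𝓝 p, g q = u q ^ 2 • 1 :=
    (hU.eventually_mem hp).mono fun q hq => hg q hq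
  have hf1 := (hf p hp).differentiableAt (by norm_num)
  have hne := hf0 p hp
  have hue := hu0 p hp
  funext a
  simp only [tensionField]
  rw [hg p hp, sum_inv_conformallyFlat_plane hue, Finset.sum_sub_distrib,
    sum_christoffel_mul_conformallyFlat_plane hg' (hu p hp) hue, sub_zero]
  simp only [pullbackCovDeriv_planeInclusion, pderiv_planeInclusion,
    pderiv_const, zero_add, mul_ite, mul_one, mul_zero, Finset.sum_ite_eq', Finset.mem_univ,
    if_true, christoffel_conformallyFlat (hh p hp) hf1 hne]
  have hzp := hz p hp
  fin_cases a <;> simp [Fin.sum_univ_two]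
  · ring_nf
    simp
  · ring_nf
    simp
  -- The normal component is `-2 f_z/(u² f)`; here `f_z = -u²` enters.
  · rw [hzp]
    field_simp

/-- The first covariant derivatives of the tension field of the plane `z = 0`. -/
theorem pullbackCovDeriv_tensionField_planeInclusion (hU : IsOpen U)
    (hg : ∀ p ∈ U, g p = u p ^ 2 • 1)
    (hu : ∀ p ∈ U, DifferentiableAt ℝ u p) (hu0 : ∀ p ∈ U, u p ≠ 0)
    (hh : ∀ p ∈ U, ∀ᶠ q in 𝓝 (planeInclusion p), h q = f q ^ 2 • 1)
    (hf : ∀ p ∈ U, ContDiffAt ℝ 2 f (planeInclusion p))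
    (hf0 : ∀ p ∈ U, f (planeInclusion p) ≠ 0)
    (hz : ∀ p ∈ U, pderiv 2 f (planeInclusion p) = -u p ^ 2) {p : Coord 2} (hp : p ∈ U)
    (i : Fin 2) :
    pullbackCovDeriv h planeInclusion (tensionField g h planeInclusion) i p
      = fun a => if a = i.castSucc then
          2 * pderiv 2 f (planeInclusion p) / (f (planeInclusion p) * f (planeInclusion p))
        else 0 := by
  have hf1 := (hf p hp).differentiableAt (by norm_num)
  have hne := hf0 p hp
  have e : tensionField g h planeInclusion =ᶠ[𝓝 p]
      fun q a => if a = 2 then 2 / f (planeInclusion q) else 0 :=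
    (hU.eventually_mem hp).mono fun q hq =>
      tensionField_planeInclusion hU hg hu hu0 hh hf hf0 hz hq
  have hd : pderiv i (fun q => 2 / f (planeInclusion q)) p
      = -(2 * pderiv i.castSucc f (planeInclusion p)) / f (planeInclusion p) ^ 2 := by
    have hF : DifferentiableAt ℝ (fun x => 2 / f x) (planeInclusion p) := by
      simpa only [div_eq_mul_inv] using
        (differentiableAt_const (2 : ℝ)).fun_mul (show DifferentiableAt ℝ (fun x => (f x)⁻¹) _ from
          hf1.inv hne)
    rw [pderiv_comp_planeInclusion (F := fun x => 2 / f x) hF,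
      pderiv_div (differentiableAt_const _) hf1 hne, pderiv_const]
    ring
  funext a
  rw [pullbackCovDeriv_congr e, pullbackCovDeriv_planeInclusion]
  simp only [mul_ite, mul_zero, Finset.sum_ite_eq', Finset.mem_univ, if_true,
    christoffel_conformallyFlat (hh p hp) hf1 hne]
  fin_cases a <;> fin_cases i <;> simp [pderiv_const] at hd ⊢
  all_goals try rw [hd]
  all_goals field_simp
  all_goals ring

/-- The trace over the plane `z = 0` of the curvature of a conformally flat metric `f² I`, at a
point where `∂²f/∂z² = 0` and `f` satisfies the Laplace equation in `x, y`. -/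
theorem sum_curvature_conformallyFlat {p : Coord 3} (hh : ∀ᶠ q in 𝓝 p, h q = f q ^ 2 • 1)
    (hf : ContDiffAt ℝ 2 f p) (hf0 : f p ≠ 0) (hzz : pderiv 2 (pderiv 2 f) p = 0)
    (hΔ : ∑ i : Fin 2, pderiv i.castSucc (pderiv i.castSucc f) p = 0) (a : Fin 3) :
    ∑ i : Fin 2, curvature h a i.castSucc 2 i.castSucc p
      = if a = 2 then -2 * pderiv 2 f p ^ 2 / f p ^ 2
        else (pderiv a (pderiv 2 f) p * f p - 2 * pderiv 2 f p * pderiv a f p) / f p ^ 2 := by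
  have hf1 := hf.differentiableAt (by norm_num)
  have c0 : pderiv 2 (pderiv 0 f) p = pderiv 0 (pderiv 2 f) p := hf.pderiv_comm
  have c1 : pderiv 2 (pderiv 1 f) p = pderiv 1 (pderiv 2 f) p := hf.pderiv_comm
  simp only [Fin.sum_univ_two] at hΔ ⊢
  -- The normal component is `-Ric(∂_z, ∂_z) = (f_xx + f_yy + 2 f_zz)/f - 2 f_z²/f²`, so only the
  -- last term survives.
  replace hΔ : pderiv 0 (pderiv 0 f) p = -pderiv 1 (pderiv 1 f) p := by
    have : (Fin.castSucc (0 : Fin 2)) = 0 := rfl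
    have : (Fin.castSucc (1 : Fin 2)) = 1 := rfl
    simp only [*] at hΔ
    linarith
  simp only [curvature, Fin.sum_univ_three, pderiv_christoffel_conformallyFlat hh hf hf0,
    pderiv_logDeriv hf hf0, christoffel_conformallyFlat hh hf1 hf0]
  fin_cases a <;> simp [hzz, hΔ, c0, c1] <;> field_simp <;> ring

/-- With `S = 2 f_z/f²` and `∇_i τ = S ∂_i`, the trace of the second derivatives has tangential part
the coordinate gradient of `S`, since the tangential Christoffel traces cancel in dimension two, and
normal part `S · (-2 f_z/f)`. Both agree with the curvature trace applied to `τ = (2/f) ∂_z`. -/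
theorem isBiharmonicMapOn_planeInclusion (hU : IsOpen U) (hg : ∀ p ∈ U, g p = u p ^ 2 • 1)
    (hu : ∀ p ∈ U, DifferentiableAt ℝ u p) (hu0 : ∀ p ∈ U, u p ≠ 0)
    (hh : ∀ p ∈ U, ∀ᶠ q in 𝓝 (planeInclusion p), h q = f q ^ 2 • 1)
    (hf : ∀ p ∈ U, ContDiffAt ℝ 2 f (planeInclusion p))
    (hf0 : ∀ p ∈ U, f (planeInclusion p) ≠ 0)
    (hz : ∀ p ∈ U, pderiv 2 f (planeInclusion p) = -u p ^ 2)
    (hzz : ∀ p ∈ U, pderiv 2 (pderiv 2 f) (planeInclusion p) = 0)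
    (hΔ : ∀ p ∈ U, ∑ i : Fin 2, pderiv i.castSucc (pderiv i.castSucc f) (planeInclusion p) = 0) :
    IsBiharmonicMapOn g h planeInclusion U := by
  intro p hp
  have hg' : ∀ᶠ q in 𝓝 p, g q = u q ^ 2 • 1 :=
    (hU.eventually_mem hp).mono fun q hq => hg q hq
  have hf1 := (hf p hp).differentiableAt (by norm_num)
  have hd := (hf p hp).differentiableAt_pderiv (i := 2)
  have hne := hf0 p hp
  have hue := hu0 p hp
  -- The derivative of `S` is `2/f` times the tangential curvature trace.
  have hS : ∀ i, pderiv i (fun q : Coord 2 => 2 * pderiv 2 f (planeInclusion q)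
        / (f (planeInclusion q) * f (planeInclusion q))) p
      = 2 * (pderiv i.castSucc (pderiv 2 f) (planeInclusion p) * f (planeInclusion p)
        - 2 * pderiv 2 f (planeInclusion p) * pderiv i.castSucc f (planeInclusion p))
        / f (planeInclusion p) ^ 3 := by
    intro i
    have h2 : DifferentiableAt ℝ (fun x => 2 * pderiv 2 f x) (planeInclusion p) :=
      (differentiableAt_const _).fun_mul hd
    have hff : DifferentiableAt ℝ (fun x => f x * f x) (planeInclusion p) := hf1.fun_mul hf1
    have hff0 : f (planeInclusion p) * f (planeInclusion p) ≠ 0 := mul_ne_zero hne hne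
    have hF : DifferentiableAt ℝ (fun x => 2 * pderiv 2 f x / (f x * f x)) (planeInclusion p) := by
      simpa only [div_eq_mul_inv] using
        h2.fun_mul (show DifferentiableAt ℝ (fun x => (f x * f x)⁻¹) _ from hff.inv hff0)
    rw [pderiv_comp_planeInclusion (F := fun x => 2 * pderiv 2 f x / (f x * f x)) hF,
      pderiv_div h2 hff hff0, pderiv_mul (differentiableAt_const _) hd, pderiv_mul hf1 hf1,
      pderiv_const]
    field_simp
    ring
  have e : ∀ i, pullbackCovDeriv h planeInclusion (tensionField g h planeInclusion) i =ᶠ[𝓝 p]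
      fun q a => if a = i.castSucc then 2 * pderiv 2 f (planeInclusion q)
        / (f (planeInclusion q) * f (planeInclusion q)) else 0 := fun i =>
    (hU.eventually_mem hp).mono fun q hq =>
      pullbackCovDeriv_tensionField_planeInclusion hU hg hu hu0 hh hf hf0 hz hq i
  have hR := sum_curvature_conformallyFlat (hh p hp) (hf p hp) hne (hzz p hp) (hΔ p hp)
  funext a
  simp only [bitensionField, Pi.zero_apply]
  rw [hg p hp, sum_inv_conformallyFlat_plane hue, sum_inv_conformallyFlat_plane hue,
    Finset.sum_sub_distrib, sum_christoffel_mul_conformallyFlat_plane hg' (hu p hp) hue, sub_zero]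
  have h1 : ∀ i, pullbackCovDeriv h planeInclusion (fun q =>
      pullbackCovDeriv h planeInclusion (tensionField g h planeInclusion) i q) i p a
      = pullbackCovDeriv h planeInclusion (fun q a => if a = i.castSucc then
        2 * pderiv 2 f (planeInclusion q)
        / (f (planeInclusion q) * f (planeInclusion q)) else 0) i p a := fun i =>
    pullbackCovDeriv_congr (e i) i a
  simp only [h1, pullbackCovDeriv_planeInclusion,
    tensionField_planeInclusion hU hg hu hu0 hh hf hf0 hz hp, pderiv_planeInclusion,
    mul_ite, mul_one, mul_zero, ite_mul, zero_mul, Finset.sum_ite_eq',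
    Finset.mem_univ, if_true]
  rw [← Finset.sum_mul, hR]
  simp only [christoffel_conformallyFlat (hh p hp) hf1 hne]
  have hS0 := hS 0
  have hS1 := hS 1
  fin_cases a <;> simp [Fin.sum_univ_two, pderiv_const] at hS0 hS1 ⊢
  · rw [hS0]
    field_simp
    ring
  · rw [hS1]
    field_simp
    ring
  · field_simp
    ring

end biharmonic

/-! ### The metric `β⁻² h₀` -/

/-- The squared length `1 - x² - y²`, that is `ρ²`. -/
def rhoSq (p : Coord 3) : ℝ := 1 - p 0 ^ 2 - p 1 ^ 2

/-- The function `f` with `β⁻² h₀ = f² (dx² + dy² + dz²)`. -/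
noncomputable def spaceFactor (w : Coord 2 → ℝ) (p : Coord 3) : ℝ :=
  w !₂[p 0, p 1] - 2 * p 2 / (rhoSq p * (rhoSq p - p 2 ^ 2))
    - 2 / √(rhoSq p) ^ 3 * Real.arctan (p 2 / √(rhoSq p))

/-- The part of the unit ball over `U`. -/
def ballOver (U : Set (Coord 2)) : Set (Coord 3) :=
  {p | p ∈ Metric.ball (0 : Coord 3) 1 ∧ !₂[p 0, p 1] ∈ U}

/-- The projection to the plane `z = 0`. -/
noncomputable def planeProjection : Coord 3 →L[ℝ] Coord 2 :=
  LinearMap.toContinuousLinearMap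
    { toFun := fun p => !₂[p 0, p 1]
      map_add' := fun x y => by
        ext i
        fin_cases i <;> simp
      map_smul' := fun c x => by
        ext i
        fin_cases i <;> simp }

section
variable {U : Set (Coord 2)} {w : Coord 2 → ℝ} {p : Coord 3}

theorem isOpen_ballOver (hU : IsOpen U) : IsOpen (ballOver U) :=
  Metric.isOpen_ball.inter (hU.preimage planeProjection.continuous)

theorem one_sub_norm_sq (p : Coord 3) : 1 - ‖p‖ ^ 2 = rhoSq p - p 2 ^ 2 := by
  rw [EuclideanSpace.real_norm_sq_eq, Fin.sum_univ_three, rhoSq]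
  ring

theorem rhoSq_sub_pos (hp : p ∈ ballOver U) : 0 < rhoSq p - p 2 ^ 2 := by
  have h : ‖p‖ < 1 := by simpa using hp.1
  rw [← one_sub_norm_sq]
  nlinarith [norm_nonneg p]

theorem rhoSq_pos (hp : p ∈ ballOver U) : 0 < rhoSq p := by
  nlinarith [rhoSq_sub_pos hp, sq_nonneg (p 2)]

/-- The denominator of `β` is `ρ³ (ρ² - z²) f`. -/
theorem betaFn_eq (hp : p ∈ ballOver U) :
    betaFn w p = 2 / ((rhoSq p - p 2 ^ 2) * spaceFactor w p) := by
  have h1 := rhoSq_pos hp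
  have h2 := rhoSq_sub_pos hp
  have h3 : 0 < √(rhoSq p) := Real.sqrt_pos.2 h1
  have h4 : √(rhoSq p) ^ 2 = rhoSq p := Real.sq_sqrt h1.le
  have h5 : rhoFn (p 0) (p 1) = √(rhoSq p) := rfl
  rw [betaFn, h5, ← mul_div_mul_left 2 _ (pow_ne_zero 3 h3.ne'), spaceFactor]
  congr 1
  · ring
  · set r := √(rhoSq p)
    rw [← h4] at h2 ⊢
    have := h2.ne'
    field_simp
    ring

theorem conformalHyperbolicMetric_eq (hp : p ∈ ballOver U) :
    conformalHyperbolicMetric w p = spaceFactor w p ^ 2 • 1 := by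
  have h2 := (rhoSq_sub_pos hp).ne'
  rw [conformalHyperbolicMetric, hyperbolicMetric, betaFn_eq hp, one_sub_norm_sq, smul_smul]
  congr 1
  -- Where `f = 0`, division by zero makes `β` and its inverse square zero, so the identity holds
  -- over all of `U`, not only where `β > 0`.
  rcases eq_or_ne (spaceFactor w p) 0 with h | h
  · simp [h]
  · field_simp
    norm_num

/-- Since `ρ² - z² > 0` in the ball, `β` and `f` have the same sign. -/
theorem betaDomain_eq : betaDomain U w = ballOver U ∩ {p | 0 < spaceFactor w p} := by
  ext p
  constructor
  · rintro ⟨h1, h2, h3⟩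
    have hp : p ∈ ballOver U := ⟨h1, h2⟩
    rw [betaFn_eq hp] at h3
    have h4 := (div_pos_iff_of_pos_left two_pos).1 h3
    exact ⟨hp, (mul_pos_iff_of_pos_left (rhoSq_sub_pos hp)).1 h4⟩
  · rintro ⟨hp, h⟩
    refine ⟨hp.1, hp.2, ?_⟩
    rw [betaFn_eq hp]
    exact div_pos two_pos (mul_pos (rhoSq_sub_pos hp) h)

theorem contDiff_rhoSq : ContDiff ℝ ∞ rhoSq := by
  unfold rhoSq
  fun_prop

/-- Harmonicity supplies the smoothness of `w` through analyticity; the other terms are smooth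
because `ρ²` and `ρ² - z²` are positive. -/
theorem contDiffAt_spaceFactor (hw : InnerProductSpace.HarmonicOnNhd w U) (hp : p ∈ ballOver U) :
    ContDiffAt ℝ ∞ (spaceFactor w) p := by
  have h1 := rhoSq_pos hp
  have h2 := rhoSq_sub_pos hp
  have hs : ContDiffAt ℝ ∞ rhoSq p := contDiff_rhoSq.contDiffAt
  have hz : ContDiffAt ℝ ∞ (fun q : Coord 3 => q 2) p := by fun_prop
  have hr : ContDiffAt ℝ ∞ (fun q => √(rhoSq q)) p := hs.sqrt h1.ne'
  have hr0 : √(rhoSq p) ≠ 0 := (Real.sqrt_pos.2 h1).ne'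
  have hw' : ContDiffAt ℝ ∞ (fun q : Coord 3 => w !₂[q 0, q 1]) p :=
    ContDiffAt.comp (g := w) p (hw _ hp.2).analyticAt_plane.contDiffAt
      planeProjection.contDiff.contDiffAt
  refine (hw'.sub ((contDiffAt_const.mul hz).div (hs.mul (hs.sub (hz.pow 2)))
    (mul_ne_zero h1.ne' h2.ne'))).sub ?_
  exact (contDiffAt_const.div (hr.pow 3) (pow_ne_zero 3 hr0)).mul
    (Real.contDiff_arctan.contDiffAt.comp p (hz.div hr hr0))

theorem line_apply_zero (p : Coord 3) (t : ℝ) :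
    (p + t • EuclideanSpace.single 2 1 : Coord 3) 0 = p 0 := by simp
theorem line_apply_one (p : Coord 3) (t : ℝ) :
    (p + t • EuclideanSpace.single 2 1 : Coord 3) 1 = p 1 := by simp
theorem line_apply_two (p : Coord 3) (t : ℝ) :
    (p + t • EuclideanSpace.single 2 1 : Coord 3) 2 = p 2 + t := by simp

theorem rhoSq_line (p : Coord 3) (t : ℝ) :
    rhoSq (p + t • EuclideanSpace.single 2 1 : Coord 3) = rhoSq p := by
  simp only [rhoSq, line_apply_zero, line_apply_one]

/-- The result is free of `w` and even in `z`: it equals `-4/ρ⁴ = -u²` at `z = 0`, and its own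
`z`-derivative vanishes there. -/
theorem pderiv_two_spaceFactor (hw : InnerProductSpace.HarmonicOnNhd w U) (hp : p ∈ ballOver U) :
    pderiv 2 (spaceFactor w) p
      = -2 * (rhoSq p + p 2 ^ 2) / (rhoSq p * (rhoSq p - p 2 ^ 2) ^ 2)
        - 2 / (rhoSq p * (rhoSq p + p 2 ^ 2)) := by
  have h1 := rhoSq_pos hp
  have h2 := rhoSq_sub_pos hp
  refine pderiv_eq_of_hasDerivAt_line
    ((contDiffAt_spaceFactor hw hp).differentiableAt (by simp)) ?_
  simp only [spaceFactor, line_apply_zero, line_apply_one, line_apply_two, rhoSq_line]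
  have h3 : 0 < √(rhoSq p) := Real.sqrt_pos.2 h1
  have h4 : √(rhoSq p) ^ 2 = rhoSq p := Real.sq_sqrt h1.le
  set r := √(rhoSq p)
  set s := rhoSq p
  set z := p 2
  have hl : HasDerivAt (fun t : ℝ => z + t) 1 0 := (hasDerivAt_id 0).const_add z
  have ha := (hl.const_mul 2).fun_div ((((hl.fun_pow 2).const_sub s).const_mul s))
    (by simpa using (mul_pos h1 h2).ne')
  have hb := ((hl.div_const r).arctan).const_mul (2 / r ^ 3)
  refine ((ha.const_sub (w !₂[p 0, p 1])).sub hb).congr_deriv ?_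
  simp only [add_zero]
  rw [← h4] at h2 ⊢
  have := h2.ne'
  have h5 : r ^ 2 + z ^ 2 ≠ 0 := by positivity
  have h6 : 1 + (z / r) ^ 2 ≠ 0 := by positivity
  field_simp
  ring

theorem planeInclusion_mem_ballOver (hU : U ⊆ Metric.ball (0 : Coord 2) 1) {q : Coord 2}
    (hq : q ∈ U) : planeInclusion q ∈ ballOver U := by
  have h := hU hq
  have e : (!₂[planeInclusion q 0, planeInclusion q 1] : Coord 2) = q := by
    ext i
    fin_cases i <;> rfl
  refine ⟨?_, by rwa [e]⟩
  have hn : ‖planeInclusion q‖ ^ 2 = ‖q‖ ^ 2 := by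
    rw [EuclideanSpace.real_norm_sq_eq, EuclideanSpace.real_norm_sq_eq, Fin.sum_univ_three,
      Fin.sum_univ_two, planeInclusion_zero, planeInclusion_one, planeInclusion_two]
    ring
  rw [mem_ball_zero_iff] at h ⊢
  rwa [(pow_left_inj₀ (norm_nonneg _) (norm_nonneg _) two_ne_zero).1 hn]

theorem spaceFactor_planeInclusion (w : Coord 2 → ℝ) (q : Coord 2) :
    spaceFactor w (planeInclusion q) = w q := by
  have e : (!₂[planeInclusion q 0, planeInclusion q 1] : Coord 2) = q := by
    ext i
    fin_cases i <;> rfl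
  simp [spaceFactor, e, planeInclusion_two]

theorem rhoSq_planeInclusion (q : Coord 2) :
    rhoSq (planeInclusion q) = 1 - q 0 ^ 2 - q 1 ^ 2 := rfl

theorem pderiv_two_pderiv_two_spaceFactor (hU : IsOpen U)
    (hw : InnerProductSpace.HarmonicOnNhd w U) (hp : p ∈ ballOver U) (h0 : p 2 = 0) :
    pderiv 2 (pderiv 2 (spaceFactor w)) p = 0 := by
  have h1 := rhoSq_pos hp
  have e : pderiv 2 (spaceFactor w) =ᶠ[𝓝 p] fun q =>
      -2 * (rhoSq q + q 2 ^ 2) / (rhoSq q * (rhoSq q - q 2 ^ 2) ^ 2)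
        - 2 / (rhoSq q * (rhoSq q + q 2 ^ 2)) :=
    ((isOpen_ballOver hU).eventually_mem hp).mono fun q hq => pderiv_two_spaceFactor hw hq
  have hd : DifferentiableAt ℝ (pderiv 2 (spaceFactor w)) p :=
    ((contDiffAt_spaceFactor hw hp).of_le ENat.LEInfty.out).differentiableAt_pderiv
  rw [pderiv_congr e]
  refine pderiv_eq_of_hasDerivAt_line (e.differentiableAt_iff.1 hd) ?_
  simp only [line_apply_two, rhoSq_line, h0, zero_add]
  set s := rhoSq p
  -- `f_z` depends on `t` only through `t²`, which is stationary at `0`.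
  have hl : HasDerivAt (fun t : ℝ => t ^ 2) 0 0 := by simpa using hasDerivAt_pow 2 (0 : ℝ)
  have ha := ((hl.const_add s).const_mul (-2)).fun_div (((hl.const_sub s).fun_pow 2).const_mul s)
    (by simp [h1.ne'])
  have hb := (hasDerivAt_const (0 : ℝ) (2 : ℝ)).fun_div ((hl.const_add s).const_mul s)
    (by simp [h1.ne'])
  refine (ha.sub hb).congr_deriv ?_
  simp

/-- Horizontal derivatives on the plane see only the restriction of `f`, which is the harmonic `w`.
-/
theorem sum_pderiv_pderiv_spaceFactor (hU : IsOpen U) (hUd : U ⊆ Metric.ball (0 : Coord 2) 1)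
    (hw : InnerProductSpace.HarmonicOnNhd w U) {q : Coord 2} (hq : q ∈ U) :
    ∑ i : Fin 2, pderiv i.castSucc (pderiv i.castSucc (spaceFactor w)) (planeInclusion q) = 0 := by
  rw [← (hw q hq).sum_pderiv_pderiv]
  refine Finset.sum_congr rfl fun i _ => ?_
  have hc : ∀ r ∈ U, ContDiffAt ℝ 2 (spaceFactor w) (planeInclusion r) := fun r hr =>
    (contDiffAt_spaceFactor hw (planeInclusion_mem_ballOver hUd hr)).of_le ENat.LEInfty.out
  have e : pderiv i w =ᶠ[𝓝 q] fun r => pderiv i.castSucc (spaceFactor w) (planeInclusion r) := by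
    filter_upwards [hU.mem_nhds hq] with r hr
    rw [← pderiv_comp_planeInclusion ((hc r hr).differentiableAt (by norm_num))]
    simp only [spaceFactor_planeInclusion]
  rw [pderiv_congr e, pderiv_comp_planeInclusion (hc q hq).differentiableAt_pderiv]

end

/-! ### Riemannian metrics and the main theorem. -/

section
variable {U : Set (Coord 2)} {w : Coord 2 → ℝ}

theorem one_sub_norm_sq_plane (p : Coord 2) : 1 - ‖p‖ ^ 2 = 1 - p 0 ^ 2 - p 1 ^ 2 := by
  rw [EuclideanSpace.real_norm_sq_eq, Fin.sum_univ_two]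
  ring

theorem one_sub_sq_pos (hUd : U ⊆ Metric.ball (0 : Coord 2) 1) {p : Coord 2} (hp : p ∈ U) :
    0 < 1 - p 0 ^ 2 - p 1 ^ 2 :=
  rhoSq_pos (planeInclusion_mem_ballOver hUd hp)

theorem hyperbolicMetric_plane_eq (p : Coord 2) :
    hyperbolicMetric 2 p = (2 / (1 - p 0 ^ 2 - p 1 ^ 2)) ^ 2 • 1 := by
  rw [hyperbolicMetric, one_sub_norm_sq_plane, div_pow]
  norm_num

theorem isRiemannianMetricOn_conformallyFlat {n : ℕ} {g : Coord n → Matrix (Fin n) (Fin n) ℝ}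
    {f : Coord n → ℝ} {V : Set (Coord n)} (hg : ∀ p ∈ V, g p = f p ^ 2 • 1)
    (hf : ∀ p ∈ V, ContDiffAt ℝ ∞ f p) (h0 : ∀ p ∈ V, f p ≠ 0) : IsRiemannianMetricOn g V where
  smooth i j := by
    have : ContDiffOn ℝ ∞ (fun p => f p ^ 2 * (1 : Matrix (Fin n) (Fin n) ℝ) i j) V :=
      fun p hp => (((hf p hp).pow 2).mul contDiffAt_const).contDiffWithinAt
    refine this.congr fun p hp => ?_
    simp [hg p hp]
  posDef p hp := by
    rw [hg p hp]
    exact Matrix.PosDef.one.smul (by have := h0 p hp; positivity)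

end

theorem mainTheorem9
    (U : Set (Coord 2)) (hUopen : IsOpen U) (hUne : U.Nonempty)
    (hUdisk : U ⊆ Metric.ball (0 : Coord 2) 1)
    (w : Coord 2 → ℝ) (hw : InnerProductSpace.HarmonicOnNhd w U) (hwpos : ∀ p ∈ U, 0 < w p) :
    IsRiemannianMetricOn (hyperbolicMetric 2) U ∧
    IsOpen (betaDomain U w) ∧
    IsRiemannianMetricOn (conformalHyperbolicMetric w) (betaDomain U w) ∧
    IsConformalImmersionOn (hyperbolicMetric 2) (conformalHyperbolicMetric w) planeInclusion
      U (betaDomain U w) (fun p => w p * (1 - p 0 ^ 2 - p 1 ^ 2) / 2) ∧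
    IsProperBiharmonicMapOn (hyperbolicMetric 2) (conformalHyperbolicMetric w) planeInclusion U := by
  have hs : ∀ p ∈ U, 0 < 1 - p 0 ^ 2 - p 1 ^ 2 := fun p hp => one_sub_sq_pos hUdisk hp
  have hu : ∀ p ∈ U, ContDiffAt ℝ ∞ (fun p : Coord 2 => 2 / (1 - p 0 ^ 2 - p 1 ^ 2)) p :=
    fun p hp => ContDiffAt.div contDiffAt_const (by fun_prop) (hs p hp).ne'
  have hu0 : ∀ p ∈ U, 2 / (1 - p 0 ^ 2 - p 1 ^ 2) ≠ 0 := fun p hp =>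
    (div_pos two_pos (hs p hp)).ne'
  have hmem : ∀ p ∈ U, planeInclusion p ∈ ballOver U := fun p hp =>
    planeInclusion_mem_ballOver hUdisk hp
  have hh : ∀ p ∈ U, ∀ᶠ q in 𝓝 (planeInclusion p),
      conformalHyperbolicMetric w q = spaceFactor w q ^ 2 • 1 := fun p hp =>
    ((isOpen_ballOver hUopen).eventually_mem (hmem p hp)).mono fun q hq =>
      conformalHyperbolicMetric_eq hq
  have hf : ∀ p ∈ U, ContDiffAt ℝ 2 (spaceFactor w) (planeInclusion p) := fun p hp =>
    (contDiffAt_spaceFactor hw (hmem p hp)).of_le ENat.LEInfty.out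
  have hf0 : ∀ p ∈ U, spaceFactor w (planeInclusion p) ≠ 0 := fun p hp => by
    rw [spaceFactor_planeInclusion]
    exact (hwpos p hp).ne'
  have hz : ∀ p ∈ U, pderiv 2 (spaceFactor w) (planeInclusion p)
      = -(2 / (1 - p 0 ^ 2 - p 1 ^ 2)) ^ 2 := fun p hp => by
    rw [pderiv_two_spaceFactor hw (hmem p hp), rhoSq_planeInclusion, planeInclusion_two]
    have := (hs p hp).ne'
    simp only [ne_eq, OfNat.ofNat_ne_zero, not_false_eq_true, zero_pow, add_zero, sub_zero]
    field_simp
    norm_num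
  have hg : ∀ p ∈ U, hyperbolicMetric 2 p = (2 / (1 - p 0 ^ 2 - p 1 ^ 2)) ^ 2 • 1 := fun p _ =>
    hyperbolicMetric_plane_eq p
  have hud : ∀ p ∈ U, DifferentiableAt ℝ (fun p : Coord 2 => 2 / (1 - p 0 ^ 2 - p 1 ^ 2)) p :=
    fun p hp => (hu p hp).differentiableAt (by simp)
  refine ⟨isRiemannianMetricOn_conformallyFlat hg hu hu0, ?_, ?_, ⟨?_, ?_, ?_, ?_, ?_⟩, ?_, ?_⟩
  · rw [betaDomain_eq]
    exact ContinuousOn.isOpen_inter_preimage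
      (fun q hq => (contDiffAt_spaceFactor hw hq).continuousAt.continuousWithinAt)
      (isOpen_ballOver hUopen) isOpen_Ioi
  · rw [betaDomain_eq]
    exact isRiemannianMetricOn_conformallyFlat (fun p hp => conformalHyperbolicMetric_eq hp.1)
      (fun p hp => contDiffAt_spaceFactor hw hp.1) (fun p hp => ne_of_gt hp.2)
  · intro p hp
    rw [betaDomain_eq]
    refine ⟨hmem p hp, ?_⟩
    rw [Set.mem_ofPred_eq, spaceFactor_planeInclusion]
    exact hwpos p hp
  · exact contDiff_planeInclusion.contDiffOn
  · intro p _
    rw [fderiv_planeInclusion, coe_planeInclusionL]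
    intro x y hxy
    ext i
    fin_cases i
    · exact congrArg (fun q : Coord 3 => q 0) hxy
    · exact congrArg (fun q : Coord 3 => q 1) hxy
  · intro p hp
    exact div_pos (mul_pos (hwpos p hp) (hs p hp)) two_pos
  · intro p hp
    rw [hg p hp]
    ext i j
    have hsp := (hs p hp).ne'
    simp only [pullbackMetric, pderiv_planeInclusion, conformalHyperbolicMetric_eq (hmem p hp),
      spaceFactor_planeInclusion, Matrix.of_apply, Matrix.smul_apply, smul_eq_mul, mul_ite,
      mul_one, mul_zero, Finset.sum_ite_eq', Finset.mem_univ, if_true, Matrix.one_apply,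
      Fin.castSucc_inj]
    split_ifs
    · field_simp
    · simp
  · exact isBiharmonicMapOn_planeInclusion hUopen hg hud hu0 hh hf hf0 hz
      (fun p hp => pderiv_two_pderiv_two_spaceFactor hUopen hw (hmem p hp) rfl)
      (fun p hp => sum_pderiv_pderiv_spaceFactor hUopen hUdisk hw hp)
  · intro hharm
    obtain ⟨p, hp⟩ := hUne
    -- The normal component of the tension field is `2/w`, which is nonzero.
    have h := congrFun (hharm p hp) 2
    rw [tensionField_planeInclusion hUopen hg hud hu0 hh hf hf0 hz hp] at h
    simp [hf0 p hp] at h
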